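/- Let $G$ be an arbitrary simple graph, finite or infinite and not necessarily connected. In the game of Cat Herding on $G$, the cat first chooses a starting vertex. Then the players alternate: the herder deletes one edge of the current graph, and the cat moves along a non-trivial finite path of the remaining graph to a different vertex. The cat is captured as soon as it is on a vertex that has degree $0$ in the current graph. The graph $G$ is called \emph{cat-win} if the cat has a strategy (including the choice of the starting vertex) by which it is never captured, whatever edges the herder deletes. Let $B^\omega$ be the infinite complete binary tree, i.e. the graph whose vertices are the finite strings over $\{L,R\}$, with an edge between $\alpha$ and $\alpha t$ for every string $\alpha$ and every $t\in\{L,R\}$. A graph is $2$-edge-connected if any two of its vertices remain connected by a finite path after the deletion of any set of at most one edge. \textbf{Theorem.} The graph $G$ is cat-win if and only if at least one of the following holds: \begin{enumerate} \item $G$ has $B^\omega$ as a minor, i.e. there are pairwise disjoint non-empty sets $B_\alpha\subseteq V(G)$, one for each vertex $\alpha$ of $B^\omega$, each inducing a connected subgraph of $G$, such that $G$ has an edge between $B_\alpha$ and $B_\beta$ whenever $\alpha\beta$ is an edge of $B^\omega$; \item $G$ has a (not necessarily induced) $2$-edge-connected subgraph with infinitely many vertices. \end{enumerate} -/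

import Mathlib

namespace CatHerding

variable {V W : Type*}

/-- The graph that is left of `G` after all edges in the list `h` have been deleted. -/
def remaining (G : SimpleGraph V) (h : List (Sym2 V)) : SimpleGraph V :=
  G.deleteEdges {e | e ∈ h}

/-- `h` is a legal sequence of cuts of the herder on `G`, listed with the most recent cut first:
each cut deletes an edge of `G` that has not been deleted before. -/
def IsCutHistory (G : SimpleGraph V) (h : List (Sym2 V)) : Prop :=
  h.Nodup ∧ ∀ e ∈ h, e ∈ G.edgeSet

/-- A cat on the vertex `v` of the current graph `H` is captured: `v` has degree `0` in `H`. -/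
abbrev IsCaptured (H : SimpleGraph V) (v : V) : Prop :=
  H.IsIsolated v

/-- A legal move of the cat in the current graph `H`: along a non-trivial (finite) path of `H`
to a new vertex. -/
def IsCatMove (H : SimpleGraph V) (u v : V) : Prop :=
  u ≠ v ∧ ∃ p : H.Walk u v, p.IsPath

/-- A strategy of the cat assigns to each sequence of cuts made so far (most recent cut first) the
vertex that the cat occupies after its answer to the last cut; `σ []` is the starting vertex.
It is winning on `G` if the cat is not captured at the start and, after every legal sequence of
cuts, the cat on its old vertex is not captured and the strategy prescribes a legal move from it in
the graph that is left. -/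
structure IsWinningCatStrategy (G : SimpleGraph V) (σ : List (Sym2 V) → V) : Prop where
  start : ¬ IsCaptured G (σ [])
  move : ∀ (e : Sym2 V) (h : List (Sym2 V)), IsCutHistory G (e :: h) →
    ¬ IsCaptured (remaining G (e :: h)) (σ h) ∧
      IsCatMove (remaining G (e :: h)) (σ h) (σ (e :: h))

/-- `G` is cat-win: the cat has a strategy (including the choice of its starting vertex) that
evades capture forever, whatever edges the herder cuts. -/
def CatWin (G : SimpleGraph V) : Prop :=
  ∃ σ : List (Sym2 V) → V, IsWinningCatStrategy G σ

/-- The infinite complete binary tree: its vertices are the finite strings over a two-letter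
alphabet (stored with the last letter first), and each string is joined to the two strings that
extend it by one letter. -/
def infiniteBinaryTree : SimpleGraph (List Bool) where
  Adj a b := (∃ t, b = t :: a) ∨ (∃ t, a = t :: b)
  symm := ⟨fun _ _ hab => hab.symm⟩
  loopless := ⟨fun a ha => by rcases ha with ⟨t, ht⟩ | ⟨t, ht⟩ <;> simp at ht⟩

/-- `H` is a minor of `G`: there are pairwise disjoint sets of vertices of `G`, one for each vertex
of `H`, that induce (non-empty) connected subgraphs, such that any two of them that belong to
adjacent vertices of `H` are joined by an edge of `G`. -/
def IsMinor (H : SimpleGraph W) (G : SimpleGraph V) : Prop :=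
  ∃ B : W → Set V,
    (∀ x, (G.induce (B x)).Connected) ∧
    (∀ x y, x ≠ y → Disjoint (B x) (B y)) ∧
    (∀ x y, H.Adj x y → ∃ u ∈ B x, ∃ v ∈ B y, G.Adj u v)

/-- `G` has a `2`-edge-connected subgraph with infinitely many vertices. The subgraph need not be
an induced one. -/
def HasInfiniteTwoEdgeConnectedSubgraph (G : SimpleGraph V) : Prop :=
  ∃ H : G.Subgraph, H.verts.Infinite ∧ H.coe.IsEdgeConnected 2

end CatHerding

/-!
Write `K - f` for the graph `K` without the edge `f`.

An infinite 2-edge-connected subgraph exists as soon as there is an infinite set of vertices no two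
of which can be separated by deleting one edge (`hasInfiniteTwoEdgeConnectedSubgraph_iff`). Such a
set is what the cat keeps: after a cut `s(a, b)`, all new bridges lie on one path from `a` to `b`,
so that by the pigeonhole principle (`exists_infinite_isEdgeReachable_two`) infinitely many members
of the set are still inseparable. In a model of the infinite binary tree the cat sits in the
root set next to one of the two subtrees, and moves after each cut to the root set of a subtree that
the cut has spared (`catWin_of_isMinor`).

Conversely, let the cat win in the component of `r` in `K`, where `K` has no infinite inseparable
set. Call an edge `f` *winning* if the cat wins from some vertex of that component which `f`
separates from `r`, in the graph `K - f`. By `not_catWinsFrom_of_finite` there are infinitely many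
winning edges: otherwise the vertices that are cut off from `r` by winning edges only
form a finite set, whose inner edges the herder can delete one by one, while a cat that steps
outside is locked into a losing part by one cut. Hence some winning edge `e` is not on a chosen
path from `r` to the cat. If the herder cuts `e`, the cat wins on the side of `r`, and the
same argument in `K - e` gives an edge `f` that is winning there and does not separate `r` from the
end of `e` on its side. The parts cut off by `e` and by `f` are disjoint winning graphs, attached
to the connected rest around `r` (`nonempty_branching`). Iterating this along the binary tree and
keeping the rest at each node yields the model of the tree (`isMinor_of_winsInComponent`).
-/

open SimpleGraph

namespace CatHerding

variable {V : Type*}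

/-! ### Reachability after the deletion of one edge -/

theorem not_isIsolated_of_reachable {H : SimpleGraph V} {u v : V} (h : H.Reachable u v)
    (hne : u ≠ v) : ¬ H.IsIsolated u := by
  obtain ⟨p⟩ := h
  cases p with
  | nil => exact absurd rfl hne
  | cons hadj _ => exact hadj.not_isIsolated_left

/-- Deleting an edge `e` from a walk from `r` to `x` either leaves `x` reachable from `r`, or `r`
still reaches one end of `e` and the other end still reaches `x`. -/
theorem reachable_deleteEdges_or {K : SimpleGraph V} {r x : V} (h : K.Reachable r x)
    (e : Sym2 V) :
    (K.deleteEdges {e}).Reachable r x ∨ ∃ a b, e = s(a, b) ∧ K.Adj a b ∧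
      (K.deleteEdges {e}).Reachable r a ∧ (K.deleteEdges {e}).Reachable b x := by
  obtain ⟨p⟩ := h
  induction p with
  | nil => exact Or.inl (Reachable.refl _)
  | @cons r w x hadj p ih =>
    by_cases he : e = s(r, w)
    · rcases ih with ih | ⟨a, b, hab, -, -, hbx⟩
      · exact Or.inr ⟨r, w, he, hadj, Reachable.refl _, ih⟩
      · rcases Sym2.eq_iff.1 (he.symm.trans hab) with ⟨rfl, rfl⟩ | ⟨rfl, rfl⟩
        · exact Or.inr ⟨_, _, he, hadj, Reachable.refl _, hbx⟩
        · exact Or.inl hbx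
    · have hrw : (K.deleteEdges {e}).Reachable r w :=
        Adj.reachable (deleteEdges_adj.2 ⟨hadj, fun h => he h.symm⟩)
      rcases ih with ih | ⟨a, b, hab, hK, hwa, hbx⟩
      · exact Or.inl (hrw.trans ih)
      · exact Or.inr ⟨a, b, hab, hK, hrw.trans hwa, hbx⟩

theorem exists_finite_separating_edges {K : SimpleGraph V} {r x : V} (h : K.Reachable r x) :
    ∃ F : Set (Sym2 V), F.Finite ∧ ∀ f, ¬ (K.deleteEdges {f}).Reachable r x → f ∈ F := by
  obtain ⟨p⟩ := h
  exact ⟨{e | e ∈ p.edges}, p.edges.finite_toSet,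
    fun f hf => p.mem_edges_of_not_reachable_deleteEdges hf⟩

/-! ### Infinite sets of pairwise 2-edge-reachable vertices -/

/-- The graph has an infinite set of vertices no two of which can be separated by deleting a
single edge. Unlike an infinite 2-edge-connected subgraph, the set need not itself induce a
connected graph, which makes this form easy to find and to transfer between graphs. -/
def HasInfiniteInseparableSet (G : SimpleGraph V) : Prop :=
  ∃ Y : Set V, Y.Infinite ∧ ∀ x ∈ Y, ∀ y ∈ Y, G.IsEdgeReachable 2 x y

theorem HasInfiniteInseparableSet.mono {G H : SimpleGraph V} (hGH : G ≤ H)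
    (h : HasInfiniteInseparableSet G) : HasInfiniteInseparableSet H := by
  obtain ⟨Y, hY, h⟩ := h
  exact ⟨Y, hY, fun x hx y hy => (h x hx y hy).mono hGH⟩

/-- A class of 2-edge-reachability induces a 2-edge-connected subgraph, because a path between two
of its members never leaves the class. -/
theorem induce_isEdgeConnected_two (G : SimpleGraph V) (r : V) :
    ((⊤ : G.Subgraph).induce {w | G.IsEdgeReachable 2 r w}).coe.IsEdgeConnected 2 := by
  rw [isEdgeConnected_two]
  set C : Set V := {w | G.IsEdgeReachable 2 r w}
  rintro e ⟨u, hu⟩ ⟨v, hv⟩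
  have key : ∀ {a b : V} (p : (G.deleteEdges {e.map Subtype.val}).Walk a b),
      (∀ x ∈ p.support, x ∈ C) → ∀ (ha : a ∈ C) (hb : b ∈ C),
      (((⊤ : G.Subgraph).induce C).coe.deleteEdges {e}).Reachable ⟨a, ha⟩ ⟨b, hb⟩ := by
    intro a b p
    induction p with
    | nil => intro _ _ _; exact Reachable.refl _
    | @cons a w b hadj p ih =>
      intro hp ha hb
      have hw : w ∈ C := hp w (by simp)
      refine Reachable.trans (Adj.reachable ?_)
        (ih (fun x hx => hp x (by simp [hx])) hw hb)
      rw [deleteEdges_adj] at hadj ⊢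
      refine ⟨?_, ?_⟩
      · simpa using ⟨ha, hw, hadj.1⟩
      · intro he
        apply hadj.2
        rw [Set.mem_singleton_iff] at he ⊢
        rw [← he]
        rfl
  have huv : G.IsEdgeReachable 2 u v := (IsEdgeReachable.symm hu).trans hv
  obtain ⟨p, hp⟩ := (isEdgeReachable_two.1 huv (e.map Subtype.val)).exists_isPath
  refine key p (fun x hx => ?_) hu hv
  have hq : (p.mapLe (deleteEdges_le _)).IsTrail := (hp.mapLe _).isTrail
  have hux : G.IsEdgeReachable 2 u x :=
    hq.isEdgeReachable_two_of_isEdgeReachable_two huv (by simp) (by simpa using hx)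
  exact IsEdgeReachable.trans hu hux

theorem hasInfiniteTwoEdgeConnectedSubgraph_iff {G : SimpleGraph V} :
    HasInfiniteTwoEdgeConnectedSubgraph G ↔ HasInfiniteInseparableSet G := by
  constructor
  · rintro ⟨H, hinf, hH⟩
    refine ⟨H.verts, hinf, fun x hx y hy => isEdgeReachable_two.2 fun e => ?_⟩
    have hs : ({e' | e'.map Subtype.val = e} : Set (Sym2 H.verts)).encard < (2 : ℕ) := by
      refine lt_of_le_of_lt (Set.encard_le_one_iff_subsingleton.2 ?_) Nat.one_lt_ofNat
      intro a ha b hb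
      exact Sym2.map.injective Subtype.val_injective (ha.trans hb.symm)
    refine (hH ⟨x, hx⟩ ⟨y, hy⟩ hs).map
      (⟨Subtype.val, fun {a b} hab => ?_⟩ :
        H.coe.deleteEdges {e' | e'.map Subtype.val = e} →g G.deleteEdges {e})
    rw [deleteEdges_adj] at hab ⊢
    exact ⟨H.adj_sub hab.1, fun h => hab.2 (by simpa using h)⟩
  · rintro ⟨Y, hY, h⟩
    obtain ⟨r, hr⟩ := hY.nonempty
    exact ⟨(⊤ : G.Subgraph).induce {w | G.IsEdgeReachable 2 r w},
      hY.mono fun y hy => h r hr y hy, induce_isEdgeConnected_two G r⟩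

/-- If infinitely many vertices are separated from `r` only by edges of a finite set `F`, then
infinitely many of them are separated from `r` by the same edges. No edge separates two
of those, as deleting an edge from a connected graph leaves at most two components. -/
theorem exists_infinite_isEdgeReachable_two {K : SimpleGraph V} {r : V} {X : Set V}
    {F : Set (Sym2 V)} (hX : X.Infinite) (hF : F.Finite) (hr : ∀ x ∈ X, K.Reachable r x)
    (hsep : ∀ x ∈ X, ∀ f, ¬ (K.deleteEdges {f}).Reachable r x → f ∈ F) :
    ∃ Y ⊆ X, Y.Infinite ∧ ∀ x ∈ Y, ∀ y ∈ Y, K.IsEdgeReachable 2 x y := by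
  have := hF.to_subtype
  have := hX.to_subtype
  obtain ⟨c, hc⟩ := Finite.exists_infinite_fiber
    (fun x : X => {f : F | (K.deleteEdges {f.1}).Reachable r x.1})
  set T := (fun x : X => {f : F | (K.deleteEdges {f.1}).Reachable r x.1}) ⁻¹' {c}
  have hTinf : T.Infinite := Set.infinite_coe_iff.1 hc
  refine ⟨Subtype.val '' T, by rintro _ ⟨x, -, rfl⟩; exact x.2,
    hTinf.image Subtype.val_injective.injOn, ?_⟩
  rintro _ ⟨x, hx, rfl⟩ _ ⟨y, hy, rfl⟩
  refine isEdgeReachable_two.2 fun f => ?_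
  have hxy : (K.deleteEdges {f}).Reachable r x ↔ (K.deleteEdges {f}).Reachable r y := by
    by_cases hf : f ∈ F
    · have := (Set.ext_iff.1 ((hx : _ = c).trans (hy : _ = c).symm)) ⟨f, hf⟩
      exact this
    · exact iff_of_true (not_imp_comm.1 (hsep x x.2 f) hf) (not_imp_comm.1 (hsep y y.2 f) hf)
  by_cases hrx : (K.deleteEdges {f}).Reachable r x
  · exact hrx.symm.trans (hxy.1 hrx)
  · have hry := mt hxy.2 hrx
    obtain ⟨a, b, hab, -, hra, hbx⟩ := (reachable_deleteEdges_or (hr x x.2) f).resolve_left hrx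
    obtain ⟨c, d, hcd, -, hrc, hdy⟩ := (reachable_deleteEdges_or (hr y y.2) f).resolve_left hry
    rcases Sym2.eq_iff.1 (hab.symm.trans hcd) with ⟨rfl, rfl⟩ | ⟨rfl, rfl⟩
    · exact hbx.symm.trans hdy
    · exact absurd (hra.trans hdy) hry

/-- An infinite inseparable set survives the deletion of an edge `s(a, b)` up to a smaller such
set: only the edges of a path from `a` to `b` can become new bridges. -/
theorem exists_infinite_isEdgeReachable_two_deleteEdges {K : SimpleGraph V} {Y : Set V}
    (hY : Y.Infinite) (h : ∀ x ∈ Y, ∀ y ∈ Y, K.IsEdgeReachable 2 x y) (e : Sym2 V) :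
    ∃ Z ⊆ Y, Z.Infinite ∧ ∀ x ∈ Z, ∀ y ∈ Z, (K.deleteEdges {e}).IsEdgeReachable 2 x y := by
  obtain ⟨r, hr⟩ := hY.nonempty
  have hreach : ∀ x ∈ Y, (K.deleteEdges {e}).Reachable r x :=
    fun x hx => isEdgeReachable_two.1 (h r hr x hx) e
  have comm : ∀ f, (K.deleteEdges {f}).deleteEdges {e} = (K.deleteEdges {e}).deleteEdges {f} := by
    intro f
    rw [deleteEdges_deleteEdges, deleteEdges_deleteEdges, Set.union_comm]
  have le : ∀ f, (K.deleteEdges {e}).deleteEdges {f} ≤ K.deleteEdges {e} :=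
    fun f => deleteEdges_le _
  induction e with
  | h a b =>
  by_cases hab : (K.deleteEdges {s(a, b)}).Reachable a b
  · obtain ⟨F, hF, hsep⟩ := exists_finite_separating_edges hab
    refine exists_infinite_isEdgeReachable_two hY hF hreach fun x hx f hf => hsep f fun hfab => ?_
    rcases reachable_deleteEdges_or (isEdgeReachable_two.1 (h r hr x hx) f) s(a, b) with
      h1 | ⟨c, d, hcd, -, hrc, hdx⟩
    · exact hf (comm f ▸ h1)
    · rw [comm] at hrc hdx
      rcases Sym2.eq_iff.1 hcd with ⟨rfl, rfl⟩ | ⟨rfl, rfl⟩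
      · exact hf (hrc.trans (hfab.trans hdx))
      · exact hf (hrc.trans (hfab.symm.trans hdx))
  · refine exists_infinite_isEdgeReachable_two hY Set.finite_empty hreach
      fun x hx f hf => absurd ?_ hab
    rcases reachable_deleteEdges_or (isEdgeReachable_two.1 (h r hr x hx) f) s(a, b) with
      h1 | ⟨c, d, hcd, -, hrc, hdx⟩
    · exact absurd (comm f ▸ h1) hf
    · rw [comm] at hrc hdx
      have hcd' := ((hrc.mono (le f)).symm.trans (hreach x hx)).trans (hdx.mono (le f)).symm
      rcases Sym2.eq_iff.1 hcd with ⟨rfl, rfl⟩ | ⟨rfl, rfl⟩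
      · exact hcd'
      · exact hcd'.symm

/-! ### Winning positions of the cat -/

/-- A set of positions (current graph, vertex of the cat; the herder is to move) is evasive if the
cat is not captured in any of them and can answer every cut by a move back into the set. -/
def IsEvasive (S : SimpleGraph V → V → Prop) : Prop :=
  ∀ H v, S H v → ¬ H.IsIsolated v ∧ ∀ e ∈ H.edgeSet,
    ∃ u, v ≠ u ∧ (H.deleteEdges {e}).Reachable v u ∧ S (H.deleteEdges {e}) u

/-- The cat wins from the vertex `v` of the current graph `H` when the herder is to move: the
position belongs to an evasive set. The union of all evasive sets is evasive, so this is the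
largest one. -/
def CatWinsFrom (H : SimpleGraph V) (v : V) : Prop :=
  ∃ S, IsEvasive S ∧ S H v

theorem isEvasive_catWinsFrom : IsEvasive (CatWinsFrom (V := V)) := by
  rintro H v ⟨S, hS, h⟩
  refine ⟨(hS H v h).1, fun e he => ?_⟩
  obtain ⟨u, hne, hr, hu⟩ := (hS H v h).2 e he
  exact ⟨u, hne, hr, S, hS, hu⟩

/-- More edges only help the cat. If the herder cuts an edge outside the smaller graph, the cat
pretends that some edge of the smaller graph was cut instead. -/
theorem CatWinsFrom.mono {H K : SimpleGraph V} {v : V} (hHK : H ≤ K) (h : CatWinsFrom H v) :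
    CatWinsFrom K v := by
  refine ⟨fun K v => ∃ H ≤ K, CatWinsFrom H v, ?_, H, hHK, h⟩
  rintro K v ⟨H, hHK, h⟩
  obtain ⟨hiso, hmove⟩ := isEvasive_catWinsFrom H v h
  obtain ⟨w, hw⟩ := exists_adj_iff_not_isIsolated.2 hiso
  refine ⟨(hHK hw).not_isIsolated_left, fun e he => ?_⟩
  by_cases heH : e ∈ H.edgeSet
  · obtain ⟨u, hne, hr, hu⟩ := hmove e heH
    exact ⟨u, hne, hr.mono (deleteEdges_mono hHK), _, deleteEdges_mono hHK, hu⟩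
  · obtain ⟨u, hne, hr, hu⟩ := hmove s(v, w) hw
    have hle : H.deleteEdges {s(v, w)} ≤ K.deleteEdges {e} := by
      intro x y hxy
      have hxyH := (deleteEdges_le _) hxy
      refine deleteEdges_adj.2 ⟨hHK hxyH, fun h => heH ?_⟩
      rw [← Set.mem_singleton_iff.1 h]
      exact hxyH
    exact ⟨u, hne, hr.mono hle, _, hle, hu⟩

theorem remaining_nil (G : SimpleGraph V) : remaining G [] = G := by
  simp [remaining]

theorem remaining_cons (G : SimpleGraph V) (e : Sym2 V) (h : List (Sym2 V)) :
    remaining G (e :: h) = (remaining G h).deleteEdges {e} := by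
  rw [remaining, remaining, deleteEdges_deleteEdges]
  congr 1
  ext f
  simp

theorem isCutHistory_cons {G : SimpleGraph V} {e : Sym2 V} {h : List (Sym2 V)} :
    IsCutHistory G (e :: h) ↔ IsCutHistory G h ∧ e ∈ (remaining G h).edgeSet := by
  simp only [IsCutHistory, remaining, edgeSet_deleteEdges, List.nodup_cons, List.forall_mem_cons,
    Set.mem_sdiff, Set.mem_ofPred_eq]
  tauto

open Classical in
/-- The strategy of staying inside a set `S` of positions whenever possible, starting at `v`. -/
noncomputable def strategyOf (G : SimpleGraph V) (S : SimpleGraph V → V → Prop) (v : V) :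
    List (Sym2 V) → V
  | [] => v
  | e :: h =>
    if hu : ∃ u, strategyOf G S v h ≠ u ∧
        ((remaining G h).deleteEdges {e}).Reachable (strategyOf G S v h) u ∧
        S ((remaining G h).deleteEdges {e}) u
    then hu.choose else v

theorem catWin_iff {G : SimpleGraph V} : CatWin G ↔ ∃ v, CatWinsFrom G v := by
  constructor
  · rintro ⟨σ, hσ⟩
    refine ⟨σ [], fun H v => ∃ h, IsCutHistory G h ∧ remaining G h = H ∧ σ h = v, ?_,
      [], by simp [IsCutHistory], remaining_nil G, rfl⟩
    rintro _ _ ⟨h, hh, rfl, rfl⟩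
    constructor
    · cases h with
      | nil => rw [remaining_nil]; exact hσ.start
      | cons e h =>
        obtain ⟨-, hne, p, -⟩ := hσ.move e h hh
        exact not_isIsolated_of_reachable p.reachable.symm hne.symm
    · intro e he
      have hh' := isCutHistory_cons.2 ⟨hh, he⟩
      obtain ⟨-, hne, p, -⟩ := hσ.move e h hh'
      rw [← remaining_cons]
      exact ⟨_, hne, p.reachable, e :: h, hh', rfl, rfl⟩
  · rintro ⟨v, S, hS, hv⟩
    have step : ∀ e h, S (remaining G h) (strategyOf G S v h) → IsCutHistory G (e :: h) →
        strategyOf G S v h ≠ strategyOf G S v (e :: h) ∧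
        (remaining G (e :: h)).Reachable (strategyOf G S v h) (strategyOf G S v (e :: h)) ∧
        S (remaining G (e :: h)) (strategyOf G S v (e :: h)) := by
      intro e h hSh hh
      have hu := (hS _ _ hSh).2 e (isCutHistory_cons.1 hh).2
      have heq : strategyOf G S v (e :: h) = hu.choose := by
        rw [strategyOf, dif_pos hu]
      rw [heq, remaining_cons]
      exact hu.choose_spec
    have inv : ∀ h, IsCutHistory G h → S (remaining G h) (strategyOf G S v h) := by
      intro h
      induction h with
      | nil => intro _; rw [remaining_nil]; exact hv
      | cons e h ih => exact fun hh => (step e h (ih (isCutHistory_cons.1 hh).1) hh).2.2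
    refine ⟨strategyOf G S v, (hS _ _ hv).1, fun e h hh => ?_⟩
    obtain ⟨hne, hr, -⟩ := step e h (inv h (isCutHistory_cons.1 hh).1) hh
    exact ⟨not_isIsolated_of_reachable hr hne, hne, hr.exists_isPath⟩

/-! ### The two structures let the cat win -/

/-- The cat stays in an infinite inseparable set, which it shrinks after every cut. -/
theorem catWin_of_hasInfiniteInseparableSet {G : SimpleGraph V}
    (h : HasInfiniteInseparableSet G) : CatWin G := by
  obtain ⟨Y, hY, h⟩ := h
  obtain ⟨r, hr⟩ := hY.nonempty
  refine catWin_iff.2 ⟨r, fun H v => ∃ Y : Set V, Y.Infinite ∧ v ∈ Y ∧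
    ∀ x ∈ Y, ∀ y ∈ Y, H.IsEdgeReachable 2 x y, ?_, Y, hY, hr, h⟩
  rintro H v ⟨Y, hY, hv, h⟩
  constructor
  · obtain ⟨u, hu, hne⟩ := hY.exists_notMem_finite (Set.finite_singleton v)
    exact not_isIsolated_of_reachable ((h v hv u hu).reachable two_ne_zero) (Ne.symm hne)
  · intro e _
    obtain ⟨Z, hZY, hZ, hZr⟩ := exists_infinite_isEdgeReachable_two_deleteEdges hY h e
    obtain ⟨u, hu, hne⟩ := hZ.exists_notMem_finite (Set.finite_singleton v)
    exact ⟨u, Ne.symm hne, isEdgeReachable_two.1 (h v hv u (hZY hu)) e, Z, hZ, hu, hZr⟩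

/-- The sets `B α` witness that the infinite binary tree is a minor of `G`. -/
def IsBinaryTreeModel (G : SimpleGraph V) (B : List Bool → Set V) : Prop :=
  (∀ x, (G.induce (B x)).Connected) ∧
    (∀ x y, x ≠ y → Disjoint (B x) (B y)) ∧
    (∀ x y, infiniteBinaryTree.Adj x y → ∃ u ∈ B x, ∃ v ∈ B y, G.Adj u v)

/-- The part of a model that belongs to one of the two subtrees below the root survives the
deletion of an edge with an end outside that part. -/
theorem IsBinaryTreeModel.subtree {G : SimpleGraph V} {B : List Bool → Set V}
    (hB : IsBinaryTreeModel G B) (t : Bool) {e : Sym2 V} {z : V} (hz : z ∈ e)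
    (hzB : ∀ a, z ∉ B (a ++ [t])) :
    IsBinaryTreeModel (G.deleteEdges {e}) fun a => B (a ++ [t]) := by
  have hadj : ∀ {a b x y}, x ∈ B (a ++ [t]) → y ∈ B (b ++ [t]) → G.Adj x y →
      (G.deleteEdges {e}).Adj x y := by
    intro a b x y hx hy hxy
    refine deleteEdges_adj.2 ⟨hxy, fun h => ?_⟩
    rw [← Set.mem_singleton_iff.1 h, Sym2.mem_iff] at hz
    rcases hz with rfl | rfl
    · exact hzB _ hx
    · exact hzB _ hy
  refine ⟨fun a => (hB.1 (a ++ [t])).mono fun x y hxy => hadj x.2 y.2 hxy,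
    fun a b hab => hB.2.1 _ _ (by simpa using hab), fun a b hab => ?_⟩
  have hab' : infiniteBinaryTree.Adj (a ++ [t]) (b ++ [t]) := by
    rcases hab with ⟨s, rfl⟩ | ⟨s, rfl⟩
    · exact Or.inl ⟨s, rfl⟩
    · exact Or.inr ⟨s, rfl⟩
  obtain ⟨u, hu, v, hv, huv⟩ := hB.2.2 _ _ hab'
  exact ⟨u, hu, v, hv, hadj hu hv huv⟩

/-- The cat keeps to a vertex of the root set `B []` that has a neighbour in `B [true]`. A cut
that meets the sets of one subtree leaves the way into the other subtree intact, and the cat moves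
on to the root set of a subtree that is not affected. -/
theorem catWin_of_isMinor {G : SimpleGraph V} (h : IsMinor infiniteBinaryTree G) : CatWin G := by
  have attach : ∀ (H : SimpleGraph V) (B : List Bool → Set V), IsBinaryTreeModel H B →
      ∃ v ∈ B [], ∃ b ∈ B [true], H.Adj v b :=
    fun H B hB => hB.2.2 [] [true] (Or.inl ⟨true, rfl⟩)
  have conn : ∀ {H : SimpleGraph V} {s : Set V}, (H.induce s).Connected →
      ∀ {x y}, x ∈ s → y ∈ s → H.Reachable x y := by
    intro H s hs x y hx hy
    exact (hs.preconnected ⟨x, hx⟩ ⟨y, hy⟩).map (Embedding.induce s).toHom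
  obtain ⟨B, hB⟩ := h
  obtain ⟨v, hv, b, hb, hvb⟩ := attach G B hB
  refine catWin_iff.2 ⟨v, fun H v => ∃ B, IsBinaryTreeModel H B ∧ v ∈ B [] ∧
    ∃ b ∈ B [true], H.Adj v b, ?_, B, hB, hv, b, hb, hvb⟩
  rintro H v ⟨B, hB, hv, b, hb, hvb⟩
  refine ⟨hvb.not_isIsolated_left, fun e he => ?_⟩
  have disj : ∀ {x y z}, x ≠ y → z ∈ B x → z ∉ B y :=
    fun hxy hx hy => Set.disjoint_left.1 (hB.2.1 _ _ hxy) hx hy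
  -- A move into the root set of an intact subtree restores the invariant.
  have finish : ∀ t, IsBinaryTreeModel (H.deleteEdges {e}) (fun a => B (a ++ [t])) →
      (∃ d ∈ B [t], (H.deleteEdges {e}).Reachable v d) →
      ∃ u, v ≠ u ∧ (H.deleteEdges {e}).Reachable v u ∧
        ∃ B, IsBinaryTreeModel (H.deleteEdges {e}) B ∧ u ∈ B [] ∧
          ∃ b ∈ B [true], (H.deleteEdges {e}).Adj u b := by
    rintro t hM ⟨d, hd, hvd⟩
    obtain ⟨u, hu, w, hw, huw⟩ := attach _ _ hM
    refine ⟨u, ?_, hvd.trans (conn (hM.1 []) hd hu), _, hM, hu, w, hw, huw⟩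
    rintro rfl
    exact disj (by simp) hv hu
  by_cases hmeet : ∃ z ∈ e, ∃ a, z ∈ B (a ++ [true])
  · obtain ⟨z, hz, a, hza⟩ := hmeet
    have hM := hB.subtree false hz fun a' hza' => disj (by simp) hza hza'
    have hadj : ∀ {x y}, x ≠ z → y ≠ z → H.Adj x y → (H.deleteEdges {e}).Adj x y := by
      intro x y hx hy hxy
      refine deleteEdges_adj.2 ⟨hxy, fun h => ?_⟩
      rw [← Set.mem_singleton_iff.1 h, Sym2.mem_iff] at hz
      rcases hz with rfl | rfl
      · exact hx rfl
      · exact hy rfl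
    have hroot : ∀ {x}, x ∈ B [] → x ≠ z := by
      rintro x hx rfl
      exact disj (by simp) hx hza
    obtain ⟨c, hc, d, hd, hcd⟩ := hB.2.2 [] [false] (Or.inl ⟨false, rfl⟩)
    have hdz : d ≠ z := by
      rintro rfl
      exact disj (y := a ++ [true]) (by cases a <;> simp) hd hza
    have hconn : ((H.deleteEdges {e}).induce (B [])).Connected :=
      (hB.1 []).mono fun x y hxy => hadj (hroot x.2) (hroot y.2) hxy
    exact finish false hM
      ⟨d, hd, (conn hconn hv hc).trans (hadj (hroot hc) hdz hcd).reachable⟩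
  · push Not at hmeet
    obtain ⟨z, hz⟩ : ∃ z, z ∈ e := ⟨_, e.out_fst_mem⟩
    refine finish true (hB.subtree true hz (hmeet z hz)) ⟨b, hb, Adj.reachable ?_⟩
    refine deleteEdges_adj.2 ⟨hvb, fun h => ?_⟩
    refine hmeet b ?_ [] hb
    rw [← Set.mem_singleton_iff.1 h]
    exact Sym2.mem_mk_right v b

/-! ### Branching of winning graphs -/

/-- If only finitely many edges cut off from `r` a part in which the cat still wins, then the cat
does not win in the component of `r`. The set `X` of those vertices that are separated from `r`
by no other edges is finite, for lack of an infinite inseparable set. As soon as the cat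
leaves `X`, the herder confines it to a losing part by a single cut; until then the herder deletes
the finitely many edges inside `X`. Once these are gone, the cat cannot get from one vertex of `X`
to another, because each component outside `X` hangs on a single edge. -/
theorem not_catWinsFrom_of_finite {K : SimpleGraph V} {r : V} {F : Set (Sym2 V)}
    (hF : F.Finite) (hK : ¬ HasInfiniteInseparableSet K)
    (hwin : ∀ f x, K.Reachable r x → ¬ (K.deleteEdges {f}).Reachable r x →
      CatWinsFrom (K.deleteEdges {f}) x → f ∈ F) {v : V} (hv : K.Reachable r v) :
    ¬ CatWinsFrom K v := by
  let X : Set V := {x | K.Reachable r x ∧ ∀ f, ¬ (K.deleteEdges {f}).Reachable r x → f ∈ F}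
  have hX : X.Finite := by
    by_contra hinf
    obtain ⟨Y, -, hY, h⟩ := exists_infinite_isEdgeReachable_two hinf hF (fun x hx => hx.1)
      fun x hx => hx.2
    exact hK ⟨Y, hY, h⟩
  have hEfin : ∀ H : SimpleGraph V, {e ∈ H.edgeSet | ∀ z ∈ e, z ∈ X}.Finite := by
    intro H
    refine (hX.toFinset.sym2.finite_toSet).subset fun e he => ?_
    rw [Finset.mem_coe, Finset.mem_sym2_iff]
    exact fun z hz => hX.mem_toFinset.2 (he.2 z hz)
  have outside : ∀ H ≤ K, ∀ v, K.Reachable r v → v ∉ X → ¬ CatWinsFrom H v := by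
    intro H hH v hv hvX hcat
    obtain ⟨f, hfv, hfF⟩ : ∃ f, ¬ (K.deleteEdges {f}).Reachable r v ∧ f ∉ F := by
      by_contra! hcon
      exact hvX ⟨hv, hcon⟩
    by_cases hfH : f ∈ H.edgeSet
    · obtain ⟨u, -, hvu, hu⟩ := (isEvasive_catWinsFrom H v hcat).2 f hfH
      have hvu' := hvu.mono (deleteEdges_mono hH)
      exact hfF (hwin f u (hv.trans (hvu'.mono (deleteEdges_le _)))
        (fun h => hfv (h.trans hvu'.symm)) (hu.mono (deleteEdges_mono hH)))
    · have hle : H ≤ K.deleteEdges {f} := by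
        intro x y hxy
        refine deleteEdges_adj.2 ⟨hH hxy, fun h => hfH ?_⟩
        rw [← Set.mem_singleton_iff.1 h]
        exact hxy
      exact hfF (hwin f v hv hfv (hcat.mono hle))
  -- Without edges inside `X`, distinct vertices of `X` lie in distinct components.
  have isolated : ∀ H ≤ K, (∀ e ∈ H.edgeSet, ¬ ∀ z ∈ e, z ∈ X) → ∀ v ∈ X, ∀ u ∈ X,
      H.Reachable v u → v = u := by
    intro H hH hnone v hv u hu hvu
    obtain ⟨p, hp⟩ := hvu.exists_isPath
    cases p with
    | nil => rfl
    | @cons _ w _ hvw p =>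
      exfalso
      have hwX : w ∉ X := by
        intro hw
        refine hnone s(v, w) hvw fun z hz => ?_
        rcases Sym2.mem_iff.1 hz with rfl | rfl
        · exact hv
        · exact hw
      obtain ⟨f, hfw, hfF⟩ : ∃ f, ¬ (K.deleteEdges {f}).Reachable r w ∧ f ∉ F := by
        by_contra! hcon
        exact hwX ⟨hv.1.trans (hH hvw).reachable, hcon⟩
      have hfv := not_imp_comm.1 (hv.2 f) hfF
      have hfu := not_imp_comm.1 (hu.2 f) hfF
      have hf : s(v, w) = f := by
        by_contra hne
        exact hfw (hfv.trans (Adj.reachable (deleteEdges_adj.2 ⟨hH hvw, hne⟩)))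
      rw [Walk.cons_isPath_iff] at hp
      have hfp : f ∉ p.edges := by
        rw [← hf]
        exact fun h => hp.2 (p.fst_mem_support_of_mem_edges h)
      have hwu : (K.deleteEdges {f}).Reachable w u :=
        (p.toDeleteEdge f hfp).reachable.mono (deleteEdges_mono hH)
      exact hfw (hfu.trans hwu.symm)
  have main : ∀ n, ∀ H ≤ K, {e ∈ H.edgeSet | ∀ z ∈ e, z ∈ X}.ncard = n →
      ∀ v, K.Reachable r v → ¬ CatWinsFrom H v := by
    intro n
    induction n using Nat.strong_induction_on with
    | _ n ih =>
    intro H hH hn v hv hcat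
    have hvX : v ∈ X := by
      by_contra hvX
      exact outside H hH v hv hvX hcat
    have hreach : ∀ {e u}, (H.deleteEdges {e}).Reachable v u → K.Reachable r u :=
      fun hvu => hv.trans (hvu.mono ((deleteEdges_le _).trans hH))
    by_cases hin : ∃ e ∈ H.edgeSet, ∀ z ∈ e, z ∈ X
    · obtain ⟨e, he, heX⟩ := hin
      obtain ⟨u, -, hvu, hu⟩ := (isEvasive_catWinsFrom H v hcat).2 e he
      refine ih _ ?_ (H.deleteEdges {e}) ((deleteEdges_le _).trans hH) rfl u (hreach hvu) hu
      rw [← hn]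
      refine Set.ncard_lt_ncard ⟨fun f hf => ⟨?_, hf.2⟩, fun hsub => ?_⟩ (hEfin H)
      · exact edgeSet_mono (deleteEdges_le _) hf.1
      · have := (hsub ⟨he, heX⟩).1
        simp at this
    · push Not at hin
      obtain ⟨hiso, hmove⟩ := isEvasive_catWinsFrom H v hcat
      obtain ⟨w, hw⟩ := exists_adj_iff_not_isIsolated.2 hiso
      obtain ⟨u, hne, hvu, hu⟩ := hmove s(v, w) hw
      by_cases huX : u ∈ X
      · refine hne (isolated H hH (fun e he h => ?_) v hvX u huX (hvu.mono (deleteEdges_le _)))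
        obtain ⟨z, hz, hzX⟩ := hin e he
        exact hzX (h z hz)
      · exact outside _ ((deleteEdges_le _).trans hH) u (hreach hvu) huX hu
  exact main _ K le_rfl rfl v hv

/-- The cat wins from some vertex of the component of `r` in `K`. -/
def WinsInComponent (K : SimpleGraph V) (r : V) : Prop :=
  ∃ v, K.Reachable r v ∧ CatWinsFrom K v

/-- Two winning parts hanging off the root `r` of `K`. The connected part around `r` is the
component of `r` in the subgraph `core`; it has neighbours `root true` and `root false` in `K`,
whose components in the subgraphs `sub true` and `sub false` are winning. These three components,
taken in different subgraphs of `K`, have pairwise disjoint vertex sets. -/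
structure Branching (K : SimpleGraph V) (r : V) where
  core : SimpleGraph V
  sub : Bool → SimpleGraph V
  root : Bool → V
  core_le : core ≤ K
  sub_le : ∀ t, sub t ≤ K
  wins : ∀ t, WinsInComponent (sub t) (root t)
  attached : ∀ t, ∃ a, core.Reachable r a ∧ K.Adj a (root t)
  core_disjoint : ∀ t x, core.Reachable r x → ¬ (sub t).Reachable (root t) x
  sub_disjoint : ∀ x, (sub true).Reachable (root true) x → ¬ (sub false).Reachable (root false) x

theorem nonempty_branching {K : SimpleGraph V} {r : V} (hK : ¬ HasInfiniteInseparableSet K)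
    (h : WinsInComponent K r) : Nonempty (Branching K r) := by
  obtain ⟨v, hrv, hv⟩ := h
  -- Some edge that cuts off a winning part does not separate `v` from `r`: otherwise all such
  -- edges lie on one path from `r` to `v`.
  obtain ⟨e, x, hx, hex, hxwin, hev⟩ : ∃ e x, K.Reachable r x ∧
      ¬ (K.deleteEdges {e}).Reachable r x ∧ CatWinsFrom (K.deleteEdges {e}) x ∧
      (K.deleteEdges {e}).Reachable r v := by
    by_contra! hcon
    obtain ⟨F, hF, hsep⟩ := exists_finite_separating_edges hrv
    exact not_catWinsFrom_of_finite hF hK (fun f x h1 h2 h3 => hsep f (hcon f x h1 h2 h3)) hrv hv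
  obtain ⟨a, b, hab, hadj, hra, hbx⟩ := (reachable_deleteEdges_or hx e).resolve_left hex
  -- If the herder cuts `e`, the cat still wins on the side of `r`.
  obtain ⟨u, -, hvu, hu⟩ := (isEvasive_catWinsFrom K v hv).2 e (hab ▸ hadj)
  have hK' : ¬ HasInfiniteInseparableSet (K.deleteEdges {e}) :=
    fun h => hK (h.mono (deleteEdges_le _))
  -- On that side, some edge cuts off a winning part without separating `a` from `r`.
  obtain ⟨f, y, hy, hfy, hywin, hfa⟩ : ∃ f y, (K.deleteEdges {e}).Reachable r y ∧
      ¬ ((K.deleteEdges {e}).deleteEdges {f}).Reachable r y ∧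
      CatWinsFrom ((K.deleteEdges {e}).deleteEdges {f}) y ∧
      ((K.deleteEdges {e}).deleteEdges {f}).Reachable r a := by
    by_contra! hcon
    obtain ⟨F, hF, hsep⟩ := exists_finite_separating_edges hra
    exact not_catWinsFrom_of_finite hF hK' (fun f x h1 h2 h3 => hsep f (hcon f x h1 h2 h3))
      (hev.trans hvu) hu
  obtain ⟨c, d, -, hcd, hrc, hdy⟩ := (reachable_deleteEdges_or hy f).resolve_left hfy
  have le1 : (K.deleteEdges {e}).deleteEdges {f} ≤ K.deleteEdges {e} := deleteEdges_le _
  have le2 : K.deleteEdges {e} ≤ K := deleteEdges_le _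
  refine ⟨⟨(K.deleteEdges {e}).deleteEdges {f},
    fun t => if t then (K.deleteEdges {e}).deleteEdges {f} else K.deleteEdges {e},
    fun t => if t then d else b, le1.trans le2, ?_, ?_, ?_, ?_, ?_⟩⟩
  · rintro (_ | _)
    · exact le2
    · exact le1.trans le2
  · rintro (_ | _)
    · exact ⟨x, hbx, hxwin⟩
    · exact ⟨y, hdy, hywin⟩
  · rintro (_ | _)
    · exact ⟨a, hfa, hadj⟩
    · exact ⟨c, hrc, le2 hcd⟩
  · rintro (_ | _) z hrz hz
    · simp only [Bool.false_eq_true, if_false] at hz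
      exact hex ((hrz.mono le1).trans (hz.symm.trans hbx))
    · simp only [if_true] at hz
      exact hfy (hrz.trans (hz.symm.trans hdy))
  · intro z hdz hbz
    simp only [Bool.false_eq_true, if_false, if_true] at hdz hbz
    exact hex (((hrc.mono le1).trans hcd.reachable).trans
      ((hdz.mono le1).trans (hbz.symm.trans hbx)))

/-! ### The binary tree minor of a winning graph -/

/-- A subgraph of `G` with a root in whose component the cat wins. -/
structure WinningPart (G : SimpleGraph V) where
  graph : SimpleGraph V
  root : V
  le : graph ≤ G
  wins : WinsInComponent graph root

/-- The winning part at each node of the binary tree, given a branching of every winning part. -/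
def winningPartAt {G : SimpleGraph V} (br : ∀ P : WinningPart G, Branching P.graph P.root)
    (P₀ : WinningPart G) : List Bool → WinningPart G
  | [] => P₀
  | t :: a =>
    let P := winningPartAt br P₀ a
    ⟨(br P).sub t, (br P).root t, ((br P).sub_le t).trans P.le, (br P).wins t⟩

theorem induce_reachable_connected {L G : SimpleGraph V} (hLG : L ≤ G) (r : V) :
    (G.induce {x | L.Reachable r x}).Connected := by
  have hs : {x | L.Reachable r x} = (L.connectedComponentMk r).supp := by
    ext x
    simp [reachable_comm]
  rw [hs]
  exact (L.connectedComponentMk r).connected_toSimpleGraph.mono fun x y hxy => hLG hxy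

theorem isMinor_of_winsInComponent {G : SimpleGraph V} {r : V}
    (hG : ¬ HasInfiniteInseparableSet G) (h : WinsInComponent G r) :
    IsMinor infiniteBinaryTree G := by
  have hbr : ∀ P : WinningPart G, Nonempty (Branching P.graph P.root) :=
    fun P => nonempty_branching (fun h => hG (h.mono P.le)) P.wins
  let br : ∀ P : WinningPart G, Branching P.graph P.root := fun P => (hbr P).some
  let N := winningPartAt br ⟨G, r, le_rfl, h⟩
  -- `C a` is the whole component at the node `a`, and `B a` the part of it that is not passed on.
  let C : List Bool → Set V := fun a => {x | (N a).graph.Reachable (N a).root x}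
  let B : List Bool → Set V := fun a => {x | (br (N a)).core.Reachable (N a).root x}
  have hBC : ∀ a, B a ⊆ C a := fun a x hx => Reachable.mono (br (N a)).core_le hx
  have hCcons : ∀ t a, C (t :: a) ⊆ C a := by
    intro t a x hx
    obtain ⟨c, hc, hadj⟩ := (br (N a)).attached t
    exact (hBC a hc).trans (hadj.reachable.trans (Reachable.mono ((br (N a)).sub_le t) hx))
  have hCapp : ∀ l a, C (l ++ a) ⊆ C a := by
    intro l a
    induction l with
    | nil => exact subset_rfl
    | cons t l ih => exact (hCcons t _).trans ih
  have hdB : ∀ t a x, x ∈ B a → x ∉ C (t :: a) := fun t a => (br (N a)).core_disjoint t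
  have hdC : ∀ s t a x, x ∈ C (s :: a) → x ∈ C (t :: a) → s = t := by
    intro s t a x hs ht
    have := (br (N a)).sub_disjoint x
    cases s <;> cases t
    · rfl
    · exact absurd hs (this ht)
    · exact absurd ht (this hs)
    · rfl
  have hsuffix : ∀ a b x, x ∈ C a → x ∈ C b → a <:+ b ∨ b <:+ a := by
    intro a b x
    induction a with
    | nil => intro _ _; exact Or.inl (List.nil_suffix)
    | cons t a ih =>
      intro ha hb
      rcases ih (hCcons t a ha) hb with ⟨l, rfl⟩ | hba
      · rcases List.eq_nil_or_concat l with rfl | ⟨l, s, rfl⟩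
        · exact Or.inr ⟨[t], rfl⟩
        · have hs : x ∈ C (s :: a) := hCapp l (s :: a) (by simpa using hb)
          rw [hdC t s a x ha hs]
          exact Or.inl ⟨l, by simp⟩
      · exact Or.inr (hba.trans (List.suffix_cons t a))
  have hproper : ∀ a b x, a ≠ b → a <:+ b → x ∈ B a → x ∉ B b := by
    rintro a _ x hne ⟨l, rfl⟩ ha hb
    rcases List.eq_nil_or_concat l with rfl | ⟨l, s, rfl⟩
    · exact hne rfl
    · exact hdB s a x ha (hCapp l (s :: a) (by simpa using hBC _ hb))
  have hedge : ∀ t a, ∃ u ∈ B a, ∃ v ∈ B (t :: a), G.Adj u v := by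
    intro t a
    obtain ⟨c, hc, hadj⟩ := (br (N a)).attached t
    exact ⟨c, hc, _, Reachable.refl _, (N a).le hadj⟩
  refine ⟨B, fun a => induce_reachable_connected ((br (N a)).core_le.trans (N a).le) _,
    fun a b hab => Set.disjoint_left.2 fun x ha hb => ?_, ?_⟩
  · rcases hsuffix a b x (hBC a ha) (hBC b hb) with hs | hs
    · exact hproper a b x hab hs ha hb
    · exact hproper b a x hab.symm hs hb ha
  · rintro a b (⟨t, rfl⟩ | ⟨t, rfl⟩)
    · exact hedge t a
    · obtain ⟨u, hu, v, hv, huv⟩ := hedge t b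
      exact ⟨v, hv, u, hu, huv.symm⟩

end CatHerding

theorem mainTheorem1 {V : Type*} (G : SimpleGraph V) :
    CatHerding.CatWin G ↔
      CatHerding.IsMinor CatHerding.infiniteBinaryTree G ∨
        CatHerding.HasInfiniteTwoEdgeConnectedSubgraph G := by
  rw [CatHerding.hasInfiniteTwoEdgeConnectedSubgraph_iff]
  constructor
  · intro h
    obtain ⟨v, hv⟩ := CatHerding.catWin_iff.1 h
    by_cases hG : CatHerding.HasInfiniteInseparableSet G
    · exact Or.inr hG
    · exact Or.inl
        (CatHerding.isMinor_of_winsInComponent hG ⟨v, SimpleGraph.Reachable.refl v, hv⟩)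
  · rintro (h | h)
    · exact CatHerding.catWin_of_isMinor h
    · exact CatHerding.catWin_of_hasInfiniteInseparableSet h
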